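/- Let $E$ and $F$ be (real) Banach lattices, with norm duals $E'$ and $F'$. A sequence $(x_n)$ in $E$ is uaw-null if $|x_n|\wedge u\to 0$ weakly for every $u\in E_+$. A continuous linear operator $T:E\to F$ is uaw-Dunford–Pettis if $\|Tx_n\|\to 0$ for every norm bounded uaw-null sequence $(x_n)$ in $E$; it is weak Dunford–Pettis if $f_n(Tx_n)\to 0$ for every weakly null sequence $(x_n)$ in $E$ and every weakly null sequence $(f_n)$ in $F'$; and it is positive if $Tx\ge 0$ whenever $x\ge 0$. Then every positive uaw-Dunford–Pettis operator $T:E\to F$ is weak Dunford–Pettis, provided that at least one of the following conditions holds: 1. The lattice operations of $E$ are weakly sequentially continuous, i.e. $x_n\to 0$ weakly in $E$ implies $|x_n|\to 0$ weakly. 2. $F$ is discrete and has an order continuous norm. Here $F$ is discrete if it contains a set $A$ of pairwise disjoint discrete elements such that only $0$ is disjoint from every element of $A$, where $a>0$ is a discrete element if every $y$ with $0\le y\le a$ is a scalar multiple of $a$; the norm is order continuous if $\|x_\alpha\|\to 0$ for every net $x_\alpha\downarrow 0$ in $F$. 3. $F$ has the AM-compactness property: every weakly compact operator from $F$ to an arbitrary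 Banach space is AM-compact, i.e. maps order intervals to relatively norm compact sets. -/

import Mathlib

open Filter Topology

namespace BanachLat

universe u v

/-- A sequence in a normed space is weakly null if every continuous linear functional maps it to a
null sequence. -/
def WeaklyNull {X : Type u} [NormedAddCommGroup X] [NormedSpace ℝ X] (x : ℕ → X) : Prop :=
  ∀ f : StrongDual ℝ X, Tendsto (fun n => f (x n)) atTop (𝓝 0)

/-- Unbounded absolute weak (uaw) convergence of the sequence `x` to `a`:
`|x n - a| ⊓ w` converges weakly to `0` for every `w ≥ 0`. -/
def UawTendsto {E : Type u} [NormedAddCommGroup E] [NormedSpace ℝ E] [Lattice E]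
    (x : ℕ → E) (a : E) : Prop :=
  ∀ w : E, 0 ≤ w → WeaklyNull (fun n => |x n - a| ⊓ w)

/-- A continuous linear operator is positive if it maps the positive cone into the positive
cone. -/
def IsPositiveOperator {E : Type u} {F : Type v}
    [NormedAddCommGroup E] [NormedSpace ℝ E] [Lattice E]
    [NormedAddCommGroup F] [NormedSpace ℝ F] [Lattice F] (T : E →L[ℝ] F) : Prop :=
  ∀ x : E, 0 ≤ x → 0 ≤ T x

/-- uaw-Dunford–Pettis operators: norm bounded uaw-null sequences are mapped to norm null
sequences. -/
def IsUawDunfordPettis {E : Type u} {X : Type v}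
    [NormedAddCommGroup E] [NormedSpace ℝ E] [Lattice E]
    [NormedAddCommGroup X] [NormedSpace ℝ X] (T : E →L[ℝ] X) : Prop :=
  ∀ x : ℕ → E, (∃ C : ℝ, ∀ n, ‖x n‖ ≤ C) → UawTendsto x 0 →
    Tendsto (fun n => ‖T (x n)‖) atTop (𝓝 0)

/-- Weak Dunford–Pettis operators: `f n (T (x n)) → 0` for every weakly null sequence `x` in the
domain and every weakly null sequence `f` in the norm dual of the codomain. -/
def IsWeakDunfordPettis {X : Type u} {Y : Type v}
    [NormedAddCommGroup X] [NormedSpace ℝ X]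
    [NormedAddCommGroup Y] [NormedSpace ℝ Y] (T : X →L[ℝ] Y) : Prop :=
  ∀ (x : ℕ → X) (f : ℕ → StrongDual ℝ Y), WeaklyNull x → WeaklyNull f →
    Tendsto (fun n => f n (T (x n))) atTop (𝓝 0)

/-- The lattice operations are weakly sequentially continuous: `x n → 0` weakly implies
`|x n| → 0` weakly. -/
def WeaklySeqContLatticeOps (E : Type u) [NormedAddCommGroup E] [NormedSpace ℝ E] [Lattice E] :
    Prop :=
  ∀ x : ℕ → E, WeaklyNull x → WeaklyNull (fun n => |x n|)

/-- The norm is order continuous: every net decreasing to `0` in order is norm null. Nets are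
indexed by directed types in the universe of the space; this loses no generality, because the range
of a decreasing net, with the reversed order, is itself such an index set. -/
def OrderContinuousNorm (F : Type v) [NormedAddCommGroup F] [Lattice F] : Prop :=
  ∀ (ι : Type v) [Preorder ι] [IsDirectedOrder ι] [Nonempty ι] (x : ι → F),
    Antitone x → IsGLB (Set.range x) 0 → Tendsto (fun i => ‖x i‖) atTop (𝓝 0)

/-- A discrete element (atom): `a > 0` and every `y` with `0 ≤ y ≤ a` is a scalar multiple of
`a`. -/
def IsDiscreteElement {F : Type v} [NormedAddCommGroup F] [NormedSpace ℝ F] [Lattice F]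
    (a : F) : Prop :=
  0 < a ∧ ∀ y : F, 0 ≤ y → y ≤ a → ∃ r : ℝ, y = r • a

/-- A discrete vector lattice: there is a complete disjoint system of discrete elements, that is,
a set of pairwise disjoint discrete elements such that only `0` is disjoint from all of them. -/
def IsDiscreteLattice (F : Type v) [NormedAddCommGroup F] [NormedSpace ℝ F] [Lattice F] : Prop :=
  ∃ A : Set F, (∀ a ∈ A, IsDiscreteElement a) ∧
    (∀ a ∈ A, ∀ b ∈ A, a ≠ b → |a| ⊓ |b| = 0) ∧
    ∀ y : F, (∀ a ∈ A, |y| ⊓ |a| = 0) → y = 0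

/-- A weakly compact operator: the image of the closed unit ball is relatively compact in the weak
topology. -/
def IsWeaklyCompactOperator {Y : Type u} {X : Type v}
    [NormedAddCommGroup Y] [NormedSpace ℝ Y]
    [NormedAddCommGroup X] [NormedSpace ℝ X] (S : Y →L[ℝ] X) : Prop :=
  IsCompact (closure (toWeakSpace ℝ X '' (S '' Metric.closedBall (0 : Y) 1)))

/-- An AM-compact operator: the image of every order interval (hence of every order bounded set) is
relatively compact in norm. -/
def IsAMCompactOperator {F : Type u} {X : Type v}
    [NormedAddCommGroup F] [NormedSpace ℝ F] [Lattice F]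
    [NormedAddCommGroup X] [NormedSpace ℝ X] (S : F →L[ℝ] X) : Prop :=
  ∀ a b : F, IsCompact (closure (S '' Set.Icc a b))

/-- The AM-compactness property: every weakly compact operator into a Banach space is AM-compact.
The Banach spaces range over the universe of `F`; this loses no generality, because the closure of
the range of an operator on `F` is isometric to a Banach space in that universe. -/
def AMCompactnessProperty (F : Type v) [NormedAddCommGroup F] [NormedSpace ℝ F] [Lattice F] :
    Prop :=
  ∀ (X : Type v) [NormedAddCommGroup X] [NormedSpace ℝ X] [CompleteSpace X] (S : F →L[ℝ] X),
    IsWeaklyCompactOperator S → IsAMCompactOperator S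

end BanachLat

/-!
If the lattice operations of `E` are weakly sequentially continuous, every weakly null sequence `x`
is uaw-null, because weak nullity passes from `|x n|` to the smaller positive elements `|x n| ⊓ w`
(`WeaklyNull.of_nonneg_of_le`). Hence `‖T (x n)‖ → 0`, which suffices as weakly null sequences of
functionals are norm bounded.

Under the two conditions on `F`, the weak nullity of `x` is used only through its boundedness. A
bounded disjoint sequence is uaw-null, so `T` is M-weakly compact, and hence, being positive, it
maps the unit ball into an order interval `[-T u, T u]` up to an arbitrarily small norm error
(`IsUawDunfordPettis.exists_norm_posPart_sub_le`). It therefore suffices that a weakly null sequence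
of functionals `f n` on `F` converges to `0` uniformly on order intervals
(`IsUawDunfordPettis.tendsto_of_uniformlyNullOnIntervals`).

* If `F` is discrete with order continuous norm, each `w ≥ 0` is up to a small norm error a finite
  combination of discrete elements, so on `[0, w]` the functional `f n` is controlled by its values
  at finitely many points (`uniformlyNullOnIntervals_of_isDiscreteLattice`).
* If `F` has the AM-compactness property, it is applied to the operator `y ↦ (f n y)` into the space
  of null sequences, which is weakly compact because `f` is weakly null
  (`isWeaklyCompactOperator_toZeroAtInfty`). The image of `[0, w]` is then totally bounded, which
  amounts to uniform convergence on `[0, w]`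
  (`AMCompactnessProperty.uniformlyNullOnIntervals`).
-/

namespace BanachLat

/-! ### Disjoint elements of vector lattices -/

section Lattice

variable {E : Type*} [AddCommGroup E] [Lattice E] [IsOrderedAddMonoid E]

theorem inf_add_le {a b c : E} (ha : 0 ≤ a) (hb : 0 ≤ b) (hc : 0 ≤ c) :
    a ⊓ (b + c) ≤ a ⊓ b + a ⊓ c := by
  have h1 : a ⊓ (b + c) ≤ a ⊓ b + c := by
    rw [inf_add]
    exact inf_le_inf (le_add_of_nonneg_right hc) le_rfl
  have h2 : a ⊓ (b + c) ≤ a ⊓ b + a := inf_le_left.trans (le_add_of_nonneg_left (le_inf ha hb))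
  rw [add_inf]
  exact le_inf h2 h1

theorem inf_finset_sum_eq_zero {ι : Type*} {a : E} {z : ι → E} (ha : 0 ≤ a) {s : Finset ι}
    (hz : ∀ i ∈ s, 0 ≤ z i) (hd : ∀ i ∈ s, a ⊓ z i = 0) : a ⊓ ∑ i ∈ s, z i = 0 := by
  classical
  induction s using Finset.induction_on with
  | empty => simpa using ha
  | insert i s his ih =>
    rw [Finset.forall_mem_insert] at hz hd
    rw [Finset.sum_insert his]
    have hs := Finset.sum_nonneg hz.2
    refine le_antisymm ((inf_add_le ha hz.1 hs).trans ?_) (le_inf ha (add_nonneg hz.1 hs))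
    rw [hd.1, ih hz.2 hd.2, add_zero]

/-- A finite sum of pairwise disjoint positive elements is their supremum, so it stays below every
common upper bound. -/
theorem finset_sum_le_of_disjoint {ι : Type*} {z : ι → E} {u : E} (hu : 0 ≤ u) {s : Finset ι}
    (hz : ∀ i ∈ s, 0 ≤ z i) (hd : ∀ i ∈ s, ∀ j ∈ s, i ≠ j → z i ⊓ z j = 0)
    (hzu : ∀ i ∈ s, z i ≤ u) : ∑ i ∈ s, z i ≤ u := by
  classical
  induction s using Finset.induction_on with
  | empty => simpa using hu
  | insert i s his ih =>
    have hs : ∑ j ∈ s, z j ≤ u :=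
      ih (fun j hj => hz j (Finset.mem_insert_of_mem hj))
        (fun j hj k hk => hd j (Finset.mem_insert_of_mem hj) k (Finset.mem_insert_of_mem hk))
        (fun j hj => hzu j (Finset.mem_insert_of_mem hj))
    have h0 : z i ⊓ ∑ j ∈ s, z j = 0 := by
      refine inf_finset_sum_eq_zero (hz i (Finset.mem_insert_self i s))
        (fun j hj => hz j (Finset.mem_insert_of_mem hj)) fun j hj =>
        hd i (Finset.mem_insert_self i s) j (Finset.mem_insert_of_mem hj) ?_
      rintro rfl
      exact his hj
    rw [Finset.sum_insert his, ← inf_add_sup, h0, zero_add]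
    exact sup_le (hzu i (Finset.mem_insert_self i s)) hs

variable [Module ℝ E] [IsOrderedModule ℝ E]

theorem smul_inf_smul_eq_zero {a b : E} {s t : ℝ} (ha : 0 ≤ a) (hb : 0 ≤ b) (h : a ⊓ b = 0)
    (hs : 0 ≤ s) (ht : 0 ≤ t) : s • a ⊓ t • b = 0 := by
  refine le_antisymm ?_ (le_inf (smul_nonneg hs ha) (smul_nonneg ht hb))
  have hm : 0 < s + t + 1 := by positivity
  have key : ∀ {r : ℝ} {c : E}, 0 ≤ c → r ≤ s + t + 1 → (s + t + 1)⁻¹ • (r • c) ≤ c := by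
    intro r c hc hr
    rw [smul_smul]
    have : (s + t + 1)⁻¹ * r ≤ 1 := by
      rw [inv_mul_le_iff₀ hm]
      linarith
    simpa using smul_le_smul_of_nonneg_right this hc
  have h1 : (s + t + 1)⁻¹ • (s • a ⊓ t • b) ≤ a ⊓ b :=
    le_inf ((smul_le_smul_of_nonneg_left inf_le_left (by positivity)).trans
        (key ha (by linarith)))
      ((smul_le_smul_of_nonneg_left inf_le_right (by positivity)).trans (key hb (by linarith)))
  rw [h] at h1
  have h2 := smul_le_smul_of_nonneg_left h1 hm.le
  rwa [smul_smul, mul_inv_cancel₀ hm.ne', one_smul, smul_zero] at h2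

theorem posPart_sub_smul_inf_posPart_sub_smul (a b : E) {c : ℝ} (hc : 0 < c) :
    (a - c • b)⁺ ⊓ (b - c⁻¹ • a)⁺ = 0 := by
  have h := smul_inf_smul_eq_zero (posPart_nonneg (a - c • b)) (negPart_nonneg (a - c • b))
    (posPart_inf_negPart_eq_zero _) zero_le_one (inv_nonneg.2 hc.le)
  refine le_antisymm (le_trans (inf_le_inf (by rw [one_smul]) ?_) h.le)
    (le_inf (posPart_nonneg _) (posPart_nonneg _))
  refine sup_le ?_ (smul_nonneg (inv_nonneg.2 hc.le) (negPart_nonneg _))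
  have : b - c⁻¹ • a = c⁻¹ • -(a - c • b) := by
    rw [neg_sub, smul_sub, smul_smul, inv_mul_cancel₀ hc.ne', one_smul]
  rw [this]
  exact smul_le_smul_of_nonneg_left (neg_le_negPart _) (inv_nonneg.2 hc.le)

theorem abs_smul_le_of_abs_le_one {z : E} (hz : 0 ≤ z) {r : ℝ} (hr : |r| ≤ 1) : |r • z| ≤ z := by
  obtain ⟨h₁, h₂⟩ := abs_le.1 hr
  rw [abs_le']
  constructor
  · simpa using smul_le_smul_of_nonneg_right h₂ hz
  · rw [← neg_smul]
    simpa using smul_le_smul_of_nonneg_right (neg_le.1 h₁) hz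

theorem le_of_smul_le_smul_of_pos {a : E} (ha : 0 < a) {r t : ℝ} (h : r • a ≤ t • a) : r ≤ t := by
  by_contra! hlt
  rw [← sub_nonneg, ← sub_smul] at h
  have h' := smul_nonneg (inv_nonneg.2 (sub_pos.2 hlt).le) h
  have hne : r - t ≠ 0 := (sub_pos.2 hlt).ne'
  have : (r - t)⁻¹ * (t - r) = -1 := by
    rw [← neg_sub r t, mul_neg, inv_mul_cancel₀ hne]
  rw [smul_smul, this, neg_smul, one_smul] at h'
  exact ha.not_ge (neg_nonneg.1 h')

end Lattice

/-! ### Weakly null sequences in Banach lattices -/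

section WeaklyNull

theorem norm_le_norm_of_nonneg_of_le {E : Type*} [NormedAddCommGroup E] [Lattice E]
    [IsOrderedAddMonoid E] [HasSolidNorm E] {a b : E} (ha : 0 ≤ a) (hab : a ≤ b) : ‖a‖ ≤ ‖b‖ :=
  norm_le_norm_of_abs_le_abs (by rwa [abs_of_nonneg ha, abs_of_nonneg (ha.trans hab)])

theorem WeaklyNull.exists_norm_le {X : Type*} [NormedAddCommGroup X] [NormedSpace ℝ X]
    {x : ℕ → X} (hx : WeaklyNull x) : ∃ C : ℝ, ∀ n, ‖x n‖ ≤ C := by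
  obtain ⟨C, hC⟩ := banach_steinhaus
    (g := fun n => NormedSpace.inclusionInDoubleDualLi (E := X) ℝ (x n)) fun f => by
      obtain ⟨C, hC⟩ := (hx f).norm.bddAbove_range
      exact ⟨C, fun n => hC ⟨n, rfl⟩⟩
  exact ⟨C, fun n => (LinearIsometry.norm_map _ (x n)).symm.trans_le (hC n)⟩

variable {E : Type*} [NormedAddCommGroup E] [NormedSpace ℝ E] [Lattice E] [IsOrderedAddMonoid E]
  [IsOrderedModule ℝ E] [HasSolidNorm E]

/-- If `0 ≤ z n ≤ y n` and `y` is weakly null, then `z` is weakly null. The functional `f` need not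
be split into positive parts: the set of all `y` that dominate some `z ≥ 0` with `f z ≥ ε` is convex
and norm-bounded away from `0`, so a functional separates it strictly from `0`. -/
theorem WeaklyNull.of_nonneg_of_le {y z : ℕ → E} (hy : WeaklyNull y) (hz : ∀ n, 0 ≤ z n)
    (hzy : ∀ n, z n ≤ y n) : WeaklyNull z := by
  have key : ∀ f : StrongDual ℝ E, ∀ ε : ℝ, 0 < ε → ∀ᶠ n in atTop, f (z n) < ε := by
    intro f ε hε
    set D : Set E := {y | ∃ z, 0 ≤ z ∧ z ≤ y ∧ ε ≤ f z} with hD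
    have hconv : Convex ℝ D := by
      rintro y₁ ⟨z₁, h₁, h₁', h₁''⟩ y₂ ⟨z₂, h₂, h₂', h₂''⟩ a b ha hb hab
      refine ⟨a • z₁ + b • z₂, add_nonneg (smul_nonneg ha h₁) (smul_nonneg hb h₂),
        add_le_add (smul_le_smul_of_nonneg_left h₁' ha) (smul_le_smul_of_nonneg_left h₂' hb), ?_⟩
      simp only [map_add, map_smul, smul_eq_mul]
      calc ε = a * ε + b * ε := by rw [← add_mul, hab, one_mul]
        _ ≤ _ := by gcongr
    have h0 : (0 : E) ∉ closure D := by
      intro h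
      have hsub : D ⊆ {y | ε ≤ ‖f‖ * ‖y‖} := by
        rintro y ⟨z, h₁, h₂, h₃⟩
        calc ε ≤ f z := h₃
          _ ≤ ‖f‖ * ‖z‖ := (le_abs_self _).trans (f.le_opNorm z)
          _ ≤ ‖f‖ * ‖y‖ := by
            gcongr
            exact norm_le_norm_of_nonneg_of_le h₁ h₂
      have hcl : IsClosed {y : E | ε ≤ ‖f‖ * ‖y‖} :=
        isClosed_le continuous_const (by fun_prop)
      have := closure_minimal hsub hcl h
      simp only [Set.mem_ofPred_eq, norm_zero, mul_zero] at this
      linarith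
    obtain ⟨g, u, hu0, hu⟩ := geometric_hahn_banach_point_closed hconv.closure isClosed_closure h0
    rw [map_zero] at hu0
    filter_upwards [(hy g).eventually_lt_const hu0] with n hn
    by_contra! hcon
    exact lt_asymm hn (hu _ (subset_closure ⟨z n, hz n, hzy n, hcon⟩))
  intro f
  rw [Metric.tendsto_nhds]
  intro ε hε
  filter_upwards [key f ε hε, key (-f) ε hε] with n h₁ h₂
  rw [Real.dist_0_eq_abs, abs_lt]
  simp only [neg_apply] at h₂
  exact ⟨by linarith, h₁⟩

/-- An order bounded disjoint sequence is weakly null: each functional is absolutely summable along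
it, because the signed partial sums stay in the order interval. -/
theorem weaklyNull_of_disjoint_of_le {z : ℕ → E} {u : E} (hu : 0 ≤ u) (hz : ∀ n, 0 ≤ z n)
    (hd : ∀ m n, m ≠ n → z m ⊓ z n = 0) (hzu : ∀ n, z n ≤ u) : WeaklyNull z := by
  intro f
  have hsum : Summable fun n => |f (z n)| := by
    refine summable_of_sum_le (c := ‖f‖ * ‖u‖) (fun n => abs_nonneg _) fun s => ?_
    have h₁ : ∑ n ∈ s, |f (z n)| = f (∑ n ∈ s, (SignType.sign (f (z n)) : ℝ) • z n) := by
      simp [map_sum, sign_mul_self]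
    have h₂ : |∑ n ∈ s, (SignType.sign (f (z n)) : ℝ) • z n| ≤ u := by
      refine (Finset.le_sum_of_subadditive _ abs_zero.le abs_add_le s _).trans ?_
      refine (Finset.sum_le_sum fun n _ => abs_smul_le_of_abs_le_one (hz n) ?_).trans
        (finset_sum_le_of_disjoint hu (fun n _ => hz n) (fun m _ n _ => hd m n) fun n _ => hzu n)
      rcases SignType.sign (f (z n)) with _ | _ | _ <;> simp
    rw [h₁]
    refine (le_abs_self _).trans ((f.le_opNorm _).trans ?_)
    gcongr
    exact norm_le_norm_of_abs_le_abs (by rwa [abs_of_nonneg hu])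
  exact (tendsto_zero_iff_abs_tendsto_zero _).2 hsum.tendsto_atTop_zero

end WeaklyNull

/-! ### M-weak compactness of positive uaw-Dunford–Pettis operators -/

section MWeaklyCompact

variable {E : Type*} [NormedAddCommGroup E] [NormedSpace ℝ E] [Lattice E] [IsOrderedAddMonoid E]
  [IsOrderedModule ℝ E] [HasSolidNorm E]
  {F : Type*} [NormedAddCommGroup F] [NormedSpace ℝ F]

/-- A uaw-Dunford–Pettis operator is M-weakly compact: it maps bounded disjoint sequences to norm
null sequences, since these are uaw-null. -/
theorem IsUawDunfordPettis.tendsto_of_disjoint {T : E →L[ℝ] F} (hT : IsUawDunfordPettis T)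
    {z : ℕ → E} {C : ℝ} (hC : ∀ n, ‖z n‖ ≤ C) (hz : ∀ n, 0 ≤ z n)
    (hd : ∀ m n, m ≠ n → z m ⊓ z n = 0) : Tendsto (fun n => ‖T (z n)‖) atTop (𝓝 0) := by
  refine hT z ⟨C, hC⟩ fun w hw => ?_
  have hzw : ∀ n, |z n - 0| ⊓ w = z n ⊓ w := fun n => by rw [sub_zero, abs_of_nonneg (hz n)]
  simp only [hzw]
  refine weaklyNull_of_disjoint_of_le hw (fun n => le_inf (hz n) hw) (fun m n hmn => ?_)
    fun n => inf_le_right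
  exact le_antisymm ((inf_le_inf inf_le_left inf_le_left).trans (hd m n hmn).le)
    (le_inf (le_inf (hz m) hw) (le_inf (hz n) hw))

/-- A positive uaw-Dunford–Pettis operator maps bounded sets into order intervals up to small norm
errors. If this fails, one recursively picks positive `x n` in a ball with
`‖T (x n - 4 ^ n • (x 0 + ⋯ + x (n - 1)))⁺‖ > ε`, and these positive parts are small perturbations
of a disjoint sequence. -/
theorem IsUawDunfordPettis.exists_norm_posPart_sub_le [CompleteSpace E] [Lattice F]
    [IsOrderedAddMonoid F] [HasSolidNorm F] {T : E →L[ℝ] F} (hT : IsUawDunfordPettis T)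
    (hpos : IsPositiveOperator T) (M : ℝ) {ε : ℝ} (hε : 0 < ε) :
    ∃ u : E, 0 ≤ u ∧ ∀ x : E, 0 ≤ x → ‖x‖ ≤ M → ‖T (x - u)⁺‖ ≤ ε := by
  by_contra! hcon
  choose! g hg0 hgM hgT using hcon
  -- `s n` is the sum of the first `n` terms of the sequence `x n = g (4 ^ n • s n)`.
  let s : ℕ → E := fun n => Nat.rec 0 (fun k t => t + g ((4 : ℝ) ^ k • t)) n
  let x : ℕ → E := fun n => g ((4 : ℝ) ^ n • s n)
  have hs_succ : ∀ n, s (n + 1) = s n + x n := fun n => rfl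
  have hs0 : ∀ n, 0 ≤ s n := by
    intro n
    induction n with
    | zero => exact le_rfl
    | succ n ih =>
      rw [hs_succ]
      exact add_nonneg ih (hg0 _ (smul_nonneg (by positivity) ih))
  have h4s : ∀ n, 0 ≤ (4 : ℝ) ^ n • s n := fun n => smul_nonneg (by positivity) (hs0 n)
  have hx0 : ∀ n, 0 ≤ x n := fun n => hg0 _ (h4s n)
  have hxM : ∀ n, ‖x n‖ ≤ M := fun n => hgM _ (h4s n)
  have hs_mono : Monotone s := monotone_nat_of_le_succ fun n => by
    rw [hs_succ]
    exact le_add_of_nonneg_right (hx0 n)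
  have hxs : ∀ {m n}, m < n → x m ≤ s n := fun {m n} hmn => by
    refine le_trans ?_ (hs_mono (Nat.succ_le_of_lt hmn))
    rw [Nat.succ_eq_add_one, hs_succ]
    exact le_add_of_nonneg_left (hs0 m)
  have hsum : Summable fun n => ((1 / 2 : ℝ) ^ n) • x n := by
    refine Summable.of_norm_bounded (g := fun n => (1 / 2 : ℝ) ^ n * M)
      (summable_geometric_two.mul_right M) fun n => ?_
    rw [norm_smul, norm_pow, Real.norm_of_nonneg (by norm_num : (0 : ℝ) ≤ 1 / 2)]
    gcongr
    exact hxM n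
  obtain ⟨y, hy⟩ : ∃ y, y = ∑' n, ((1 / 2 : ℝ) ^ n) • x n := ⟨_, rfl⟩
  have hxy : ∀ n, ((1 / 2 : ℝ) ^ n) • x n ≤ y := fun n => by
    rw [hy]
    exact hsum.le_tsum n fun k _ => smul_nonneg (by positivity) (hx0 k)
  have hy0 : 0 ≤ y := (smul_nonneg (by positivity) (hx0 0)).trans (hxy 0)
  -- Subtracting `2⁻ⁿ • y` makes the elements `(x n - 4ⁿ • s n)⁺` disjoint: for `m < n`, `s n`
  -- dominates `x m`, while `2⁻ᵐ • y` dominates `2⁻ᵐ⁻ⁿ • x n` and hence `4⁻ⁿ • x n`.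
  let v : ℕ → E := fun n => (x n - (4 : ℝ) ^ n • s n - ((1 / 2 : ℝ) ^ n) • y)⁺
  have hpy : ∀ n, 0 ≤ ((1 / 2 : ℝ) ^ n) • y := fun n => smul_nonneg (by positivity) hy0
  have hlt : ∀ m n, m < n → v m ⊓ v n = 0 := by
    intro m n hmn
    refine le_antisymm ?_ (le_inf (posPart_nonneg _) (posPart_nonneg _))
    rw [← posPart_sub_smul_inf_posPart_sub_smul (x n) (x m) (c := (4 : ℝ) ^ n) (by positivity),
      inf_comm]
    refine inf_le_inf (posPart_mono ?_) (posPart_mono ?_)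
    · rw [sub_sub]
      refine sub_le_sub_left (le_add_of_le_of_nonneg ?_ (hpy n)) _
      exact smul_le_smul_of_nonneg_left (hxs hmn) (by positivity)
    · rw [sub_sub]
      refine sub_le_sub_left (le_add_of_nonneg_of_le (h4s m) ?_) _
      calc ((4 : ℝ) ^ n)⁻¹ • x n ≤ ((1 / 2 : ℝ) ^ m * (1 / 2 : ℝ) ^ n) • x n := by
            refine smul_le_smul_of_nonneg_right ?_ (hx0 n)
            have h4 : ((4 : ℝ) ^ n)⁻¹ = (1 / 2 : ℝ) ^ n * (1 / 2 : ℝ) ^ n := by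
              rw [← mul_pow, ← inv_pow]
              norm_num
            rw [h4]
            gcongr ?_ * _
            exact pow_le_pow_of_le_one (by norm_num) (by norm_num) hmn.le
        _ ≤ ((1 / 2 : ℝ) ^ m) • y := by
            rw [mul_smul]
            exact smul_le_smul_of_nonneg_left (hxy n) (by positivity)
  have hvx : ∀ n, v n ≤ x n := fun n => by
    refine sup_le ?_ (hx0 n)
    rw [sub_sub]
    exact sub_le_self _ (add_nonneg (h4s n) (hpy n))
  have hTv : Tendsto (fun n => ‖T (v n)‖) atTop (𝓝 0) := by
    refine hT.tendsto_of_disjoint (C := M)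
      (fun n => (norm_le_norm_of_nonneg_of_le (posPart_nonneg _) (hvx n)).trans (hxM n))
      (fun n => posPart_nonneg _) fun m n hmn => ?_
    rcases lt_or_gt_of_ne hmn with h | h
    · exact hlt m n h
    · rw [inf_comm]
      exact hlt n m h
  have hlim : Tendsto (fun n => ‖T (v n)‖ + (1 / 2 : ℝ) ^ n * ‖T y‖) atTop (𝓝 0) := by
    simpa using hTv.add ((tendsto_pow_atTop_nhds_zero_of_lt_one (by norm_num : (0 : ℝ) ≤ 1 / 2)
      (by norm_num)).mul_const ‖T y‖)
  obtain ⟨n, hn⟩ := (hlim.eventually_lt_const hε).exists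
  refine absurd (hgT _ (h4s n)) (not_lt.2 (le_trans ?_ hn.le))
  have hw : (x n - (4 : ℝ) ^ n • s n)⁺ ≤ v n + ((1 / 2 : ℝ) ^ n) • y := by
    refine sup_le ?_ (add_nonneg (posPart_nonneg _) (hpy n))
    rw [← sub_le_iff_le_add]
    exact le_posPart _
  have hTw : T (x n - (4 : ℝ) ^ n • s n)⁺ ≤ T (v n + ((1 / 2 : ℝ) ^ n) • y) := by
    rw [← sub_nonneg, ← map_sub]
    exact hpos _ (sub_nonneg.2 hw)
  refine (norm_le_norm_of_nonneg_of_le (hpos _ (posPart_nonneg _)) hTw).trans ?_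
  rw [map_add, map_smul]
  refine (norm_add_le _ _).trans_eq ?_
  rw [norm_smul, norm_pow, Real.norm_of_nonneg (by norm_num : (0 : ℝ) ≤ 1 / 2)]

end MWeaklyCompact

/-! ### Functionals converging uniformly on order intervals -/

section UniformlyNull

/-- The sequence `f` of functionals converges to `0` uniformly on every order interval `[0, w]`. -/
def UniformlyNullOnIntervals {F : Type*} [NormedAddCommGroup F] [NormedSpace ℝ F] [Lattice F]
    (f : ℕ → StrongDual ℝ F) : Prop :=
  ∀ w : F, 0 ≤ w → ∀ ε : ℝ, 0 < ε → ∀ᶠ n in atTop, ∀ y, 0 ≤ y → y ≤ w → |f n y| ≤ ε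

theorem IsUawDunfordPettis.tendsto_of_uniformlyNullOnIntervals {E : Type*} {F : Type*}
    [NormedAddCommGroup E] [NormedSpace ℝ E] [CompleteSpace E]
    [Lattice E] [IsOrderedAddMonoid E] [IsOrderedModule ℝ E] [HasSolidNorm E]
    [NormedAddCommGroup F] [NormedSpace ℝ F]
    [Lattice F] [IsOrderedAddMonoid F] [HasSolidNorm F]
    {T : E →L[ℝ] F} (hT : IsUawDunfordPettis T) (hpos : IsPositiveOperator T)
    {f : ℕ → StrongDual ℝ F} {C : ℝ} (hfC : ∀ n, ‖f n‖ ≤ C) (hf : UniformlyNullOnIntervals f)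
    {x : ℕ → E} {M : ℝ} (hxM : ∀ n, ‖x n‖ ≤ M) :
    Tendsto (fun n => f n (T (x n))) atTop (𝓝 0) := by
  have key : ∀ p : ℕ → E, (∀ n, 0 ≤ p n) → (∀ n, ‖p n‖ ≤ M) →
      Tendsto (fun n => f n (T (p n))) atTop (𝓝 0) := by
    intro p hp0 hpM
    have hC : 0 ≤ C := (norm_nonneg _).trans (hfC 0)
    rw [Metric.tendsto_nhds]
    intro ε hε
    obtain ⟨u, hu0, hu⟩ := hT.exists_norm_posPart_sub_le hpos M
      (ε := ε / (4 * (C + 1))) (by positivity)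
    filter_upwards [hf (T u) (hpos u hu0) (ε / 4) (by positivity)] with n hn
    have hsplit : p n = p n ⊓ u + (p n - u)⁺ := by rw [inf_eq_sub_posPart_sub, sub_add_cancel]
    have h₁ : |f n (T (p n ⊓ u))| ≤ ε / 4 := by
      refine hn _ (hpos _ (le_inf (hp0 n) hu0)) ?_
      rw [← sub_nonneg, ← map_sub]
      exact hpos _ (sub_nonneg.2 inf_le_right)
    have h₂ : |f n (T (p n - u)⁺)| ≤ ε / 4 := by
      calc |f n (T (p n - u)⁺)| ≤ ‖f n‖ * ‖T (p n - u)⁺‖ := (f n).le_opNorm _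
        _ ≤ (C + 1) * (ε / (4 * (C + 1))) := by
          gcongr
          · linarith [hfC n]
          · exact hu _ (hp0 n) (hpM n)
        _ = ε / 4 := by field_simp
    rw [Real.dist_0_eq_abs, hsplit, map_add, map_add]
    refine (abs_add_le _ _).trans_lt ?_
    linarith
  have hpos_le : ∀ n, ‖(x n)⁺‖ ≤ ‖x n‖ := fun n => norm_le_norm_of_abs_le_abs <| by
    rw [abs_of_nonneg (posPart_nonneg _)]
    exact sup_le (le_abs_self _) (abs_nonneg _)
  have hneg_le : ∀ n, ‖(x n)⁻‖ ≤ ‖x n‖ := fun n => norm_le_norm_of_abs_le_abs <| by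
    rw [abs_of_nonneg (negPart_nonneg _)]
    exact sup_le (neg_le_abs _) (abs_nonneg _)
  have h := (key (fun n => (x n)⁺) (fun n => posPart_nonneg _)
      fun n => (hpos_le n).trans (hxM n)).sub
    (key (fun n => (x n)⁻) (fun n => negPart_nonneg _) fun n => (hneg_le n).trans (hxM n))
  simpa only [← map_sub, posPart_sub_negPart, sub_zero] using h

end UniformlyNull

/-! ### Discrete lattices with order continuous norm -/

section Discrete

variable {F : Type*} [NormedAddCommGroup F] [NormedSpace ℝ F] [Lattice F] [IsOrderedAddMonoid F]
  [IsOrderedModule ℝ F] [HasSolidNorm F]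

theorem exists_isGreatest_smul_le {a w : F} (ha : 0 < a) (hw : 0 ≤ w) :
    ∃ t : ℝ, 0 ≤ t ∧ IsGreatest {r : ℝ | r • a ≤ w} t := by
  set R : Set ℝ := {r : ℝ | r • a ≤ w}
  have h0 : (0 : ℝ) ∈ R := by simpa [R] using hw
  have hbdd : BddAbove R := by
    refine ⟨‖w‖ / ‖a‖, fun r hr => ?_⟩
    rcases le_total r 0 with h | h
    · exact h.trans (by positivity)
    · rw [le_div_iff₀ (norm_pos_iff.2 ha.ne')]
      have := norm_le_norm_of_nonneg_of_le (smul_nonneg h ha.le) hr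
      rwa [norm_smul, Real.norm_of_nonneg h] at this
  have hcl : IsClosed R := isClosed_le (by fun_prop) continuous_const
  exact ⟨sSup R, le_csSup hbdd h0, hcl.csSup_mem ⟨0, h0⟩ hbdd, fun r hr => le_csSup hbdd hr⟩

/-- By the Riesz decomposition, a positive element below `∑ t i • a i + x`, with the `a i` discrete,
is a sum of multiples `r i • a i` with `0 ≤ r i ≤ t i` and of a positive element below `x`; hence
this bound on a functional. -/
theorem abs_apply_le_of_le_sum_add {ι : Type*} (g : StrongDual ℝ F) {a : ι → F} {t : ι → ℝ}
    {x : F} (hx : 0 ≤ x) {s : Finset ι} (ha : ∀ i ∈ s, IsDiscreteElement (a i))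
    (ht : ∀ i ∈ s, 0 ≤ t i) {y : F} (hy : 0 ≤ y) (hyx : y ≤ ∑ i ∈ s, t i • a i + x) :
    |g y| ≤ ∑ i ∈ s, t i * |g (a i)| + ‖g‖ * ‖x‖ := by
  classical
  induction s using Finset.induction_on generalizing y with
  | empty =>
    simp only [Finset.sum_empty, zero_add] at hyx ⊢
    refine (g.le_opNorm y).trans ?_
    gcongr
    exact norm_le_norm_of_nonneg_of_le hy hyx
  | insert i s his ih =>
    rw [Finset.forall_mem_insert] at ha ht
    rw [Finset.sum_insert his, add_assoc] at hyx ⊢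
    have hta : 0 ≤ t i • a i := smul_nonneg ht.1 ha.1.1.le
    have hsplit : y = y ⊓ t i • a i + (y - t i • a i)⁺ := by
      rw [inf_eq_sub_posPart_sub, sub_add_cancel]
    have h₁ : |g (y ⊓ t i • a i)| ≤ t i * |g (a i)| := by
      obtain ⟨r, hr0, hrt, hr⟩ : ∃ r : ℝ, 0 ≤ r ∧ r ≤ t i ∧ y ⊓ t i • a i = r • a i := by
        have hz0 : 0 ≤ y ⊓ t i • a i := le_inf hy hta
        rcases ht.1.eq_or_lt with h | h
        · refine ⟨0, le_rfl, ht.1, le_antisymm ?_ ?_⟩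
          · exact inf_le_right.trans (by rw [← h])
          · rwa [zero_smul]
        · obtain ⟨r, hr⟩ := ha.1.2 ((t i)⁻¹ • (y ⊓ t i • a i))
            (smul_nonneg (inv_nonneg.2 h.le) hz0) (by
              refine (smul_le_smul_of_nonneg_left inf_le_right (inv_nonneg.2 h.le)).trans ?_
              rw [smul_smul, inv_mul_cancel₀ h.ne', one_smul])
          have hr' : y ⊓ t i • a i = (t i * r) • a i := by
            rw [mul_smul, ← hr, smul_smul, mul_inv_cancel₀ h.ne', one_smul]
          refine ⟨t i * r, ?_, ?_, hr'⟩
          · refine le_of_smul_le_smul_of_pos ha.1.1 ?_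
            rwa [zero_smul, ← hr']
          · refine le_of_smul_le_smul_of_pos ha.1.1 ?_
            rw [← hr']
            exact inf_le_right
      rw [hr, map_smul, smul_eq_mul, abs_mul, abs_of_nonneg hr0]
      gcongr
    have h₂ : |g (y - t i • a i)⁺| ≤ ∑ j ∈ s, t j * |g (a j)| + ‖g‖ * ‖x‖ := by
      refine ih ha.2 ht.2 (posPart_nonneg _) (sup_le (sub_le_iff_le_add'.2 hyx) ?_)
      exact add_nonneg (Finset.sum_nonneg fun j hj => smul_nonneg (ht.2 j hj) (ha.2 j hj).1.le) hx
    rw [hsplit, map_add]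
    exact (abs_add_le _ _).trans (add_le_add h₁ h₂)

/-- In a discrete lattice with order continuous norm, every `w ≥ 0` is approximated in norm from
below by finite sums of multiples of discrete elements. -/
theorem IsDiscreteLattice.exists_norm_sub_sum_lt (hF : IsDiscreteLattice F)
    (hoc : OrderContinuousNorm F) {w : F} (hw : 0 ≤ w) {ε : ℝ} (hε : 0 < ε) :
    ∃ (s : Finset F) (t : F → ℝ), (∀ a ∈ s, IsDiscreteElement a) ∧ (∀ a ∈ s, 0 ≤ t a) ∧
      ∑ a ∈ s, t a • a ≤ w ∧ ‖w - ∑ a ∈ s, t a • a‖ < ε := by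
  classical
  obtain ⟨A, hA, hdisj, hcomplete⟩ := hF
  -- `t a • a` is the component of `w` in the band generated by `a`.
  choose! t ht0 ht using fun a (ha : a ∈ A) => exists_isGreatest_smul_le (hA a ha).1 hw
  have hta0 : ∀ a : A, 0 ≤ t a • (a : F) := fun a => smul_nonneg (ht0 a a.2) (hA a a.2).1.le
  have hle : ∀ s : Finset A, ∑ a ∈ s, t a • (a : F) ≤ w := fun s => by
    refine finset_sum_le_of_disjoint hw (fun a _ => hta0 a) (fun a _ b _ hab => ?_)
      fun a _ => (ht a a.2).1
    refine smul_inf_smul_eq_zero (hA a a.2).1.le (hA b b.2).1.le ?_ (ht0 a a.2) (ht0 b b.2)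
    have := hdisj a a.2 b b.2 fun h => hab (Subtype.ext h)
    rwa [abs_of_nonneg (hA a a.2).1.le, abs_of_nonneg (hA b b.2).1.le] at this
  have hlim := hoc (Finset A) (fun s => w - ∑ a ∈ s, t a • (a : F))
    (fun s s' hss' => sub_le_sub_left
      (Finset.sum_le_sum_of_subset_of_nonneg hss' fun a _ _ => hta0 a) _) ⟨?_, ?_⟩
  · obtain ⟨s, hs⟩ := (hlim.eventually_lt_const hε).exists
    refine ⟨s.map (Function.Embedding.subtype _), t, ?_, ?_, ?_, ?_⟩
    · intro a ha
      obtain ⟨b, -, rfl⟩ := Finset.mem_map.1 ha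
      exact hA b b.2
    · intro a ha
      obtain ⟨b, -, rfl⟩ := Finset.mem_map.1 ha
      exact ht0 b b.2
    · simpa using hle s
    · simpa using hs
  · rintro _ ⟨s, rfl⟩
    exact sub_nonneg.2 (hle s)
  · -- If `z` is a lower bound, then `z⁺` is disjoint from each `a ∈ A`: `z⁺ ⊓ a = r • a` gives
    -- `(r + t a) • a ≤ w`, so `r ≤ 0` by maximality of `t a`.
    intro z hz
    have hzle : ∀ s : Finset A, z⁺ ≤ w - ∑ a ∈ s, t a • (a : F) := fun s =>
      sup_le (hz ⟨s, rfl⟩) (sub_nonneg.2 (hle s))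
    suffices z⁺ = 0 from posPart_eq_zero.1 this
    refine hcomplete _ fun a ha => ?_
    have ha0 := (hA a ha).1
    rw [abs_of_nonneg (posPart_nonneg z), abs_of_nonneg ha0.le]
    have hinf0 : 0 ≤ z⁺ ⊓ a := le_inf (posPart_nonneg z) ha0.le
    obtain ⟨r, hr⟩ := (hA a ha).2 (z⁺ ⊓ a) hinf0 inf_le_right
    have h₁ : r • a ≤ w - t a • a := by
      rw [← hr]
      simpa using inf_le_left.trans (hzle {⟨a, ha⟩})
    have h₂ : r + t a ≤ t a := (ht a ha).2 (by
      change (r + t a) • a ≤ w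
      rw [add_smul]
      exact le_sub_iff_add_le.1 h₁)
    refine le_antisymm ?_ hinf0
    rw [hr]
    exact smul_nonpos_of_nonpos_of_nonneg (by linarith) ha0.le

theorem uniformlyNullOnIntervals_of_isDiscreteLattice (hF : IsDiscreteLattice F)
    (hoc : OrderContinuousNorm F) {f : ℕ → StrongDual ℝ F} {C : ℝ} (hfC : ∀ n, ‖f n‖ ≤ C)
    (hf : ∀ y, Tendsto (fun n => f n y) atTop (𝓝 0)) : UniformlyNullOnIntervals f := by
  intro w hw ε hε
  have hC : 0 ≤ C := (norm_nonneg _).trans (hfC 0)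
  obtain ⟨s, t, hs, ht, hsw, hnorm⟩ := hF.exists_norm_sub_sum_lt hoc hw
    (ε := ε / (2 * (C + 1))) (by positivity)
  have hlim : Tendsto (fun n => ∑ a ∈ s, t a * |f n a|) atTop (𝓝 0) := by
    simpa using tendsto_finsetSum s fun a _ => (hf a).abs.const_mul (t a)
  filter_upwards [hlim.eventually_lt_const (half_pos hε)] with n hn y hy0 hyw
  refine (abs_apply_le_of_le_sum_add (f n) (sub_nonneg.2 hsw) hs ht hy0
    (by rwa [add_sub_cancel])).trans ?_
  have : ‖f n‖ * ‖w - ∑ a ∈ s, t a • a‖ ≤ ε / 2 := by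
    calc ‖f n‖ * ‖w - ∑ a ∈ s, t a • a‖ ≤ (C + 1) * (ε / (2 * (C + 1))) := by
          gcongr
          linarith [hfC n]
      _ = ε / 2 := by field_simp
  linarith

end Discrete

/-! ### Weakly compact operators into spaces of null families -/

section WeaklyCompact

open ZeroAtInfty

variable {D : Type*} [TopologicalSpace D]

theorem norm_zeroAtInfty_le {x : C₀(D, ℝ)} {c : ℝ} (hc : 0 ≤ c) (h : ∀ d, |x d| ≤ c) : ‖x‖ ≤ c := by
  rw [← ZeroAtInftyContinuousMap.norm_toBCF_eq_norm]
  exact (BoundedContinuousFunction.norm_le hc).2 h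

theorem abs_apply_le_norm_zeroAtInfty (x : C₀(D, ℝ)) (d : D) : |x d| ≤ ‖x‖ := by
  rw [← ZeroAtInftyContinuousMap.norm_toBCF_eq_norm]
  exact x.toBCF.norm_coe_le_norm d

variable [DiscreteTopology D]

/-- The element of `C₀(D, ℝ)`, for a discrete space `D`, given by a function that vanishes at
infinity. -/
def zeroAtInftyOfTendsto (x : D → ℝ) (hx : Tendsto x (cocompact D) (𝓝 0)) : C₀(D, ℝ) where
  toFun := x
  continuous_toFun := continuous_of_discreteTopology
  zero_at_infty' := hx

open Classical in
/-- The unit vector of `C₀(D, ℝ)`, for a discrete space `D`, supported at `d`. -/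
noncomputable def zeroAtInftySingle (d : D) : C₀(D, ℝ) :=
  zeroAtInftyOfTendsto (Pi.single d 1) (by
    rw [cocompact_eq_cofinite]
    refine tendsto_const_nhds.congr' ?_
    filter_upwards [(Set.finite_singleton d).compl_mem_cofinite] with i hi
    rw [Pi.single_eq_of_ne (by simpa using hi)])

open Classical in
theorem sum_smul_zeroAtInftySingle_apply (s : Finset D) (c : D → ℝ) (i : D) :
    (∑ d ∈ s, c d • zeroAtInftySingle d) i = if i ∈ s then c i else 0 := by
  have h : ∀ d, zeroAtInftySingle d i = if i = d then 1 else 0 := fun d => by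
    change (Pi.single d (1 : ℝ) : D → ℝ) i = _
    rw [Pi.single_apply]
  induction s using Finset.induction_on with
  | empty => simp
  | insert j s hj ih =>
    rw [Finset.sum_insert hj, ZeroAtInftyContinuousMap.add_apply,
      ZeroAtInftyContinuousMap.smul_apply, ih, h]
    by_cases hij : i = j
    · subst hij
      simp [hj]
    · simp [hij]

theorem hasSum_zeroAtInftySingle (x : C₀(D, ℝ)) :
    HasSum (fun d => x d • zeroAtInftySingle d) x := by
  classical
  rw [HasSum, Metric.tendsto_nhds]
  intro ε hε
  have hfin : {d | ¬ |x d| < ε / 2}.Finite := by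
    have := (ZeroAtInftyContinuousMapClass.zero_at_infty x).abs.eventually_lt_const
      (show |(0 : ℝ)| < ε / 2 by simpa using hε)
    rwa [cocompact_eq_cofinite] at this
  filter_upwards [eventually_ge_atTop hfin.toFinset] with s hs
  rw [dist_eq_norm]
  refine (norm_zeroAtInfty_le (half_pos hε).le fun d => ?_).trans_lt (half_lt_self hε)
  rw [ZeroAtInftyContinuousMap.sub_apply, sum_smul_zeroAtInftySingle_apply]
  split_ifs with hd
  · simpa using (half_pos hε).le
  · rw [zero_sub, abs_neg]
    by_contra! hcon
    exact hd (hs (hfin.mem_toFinset.2 (not_lt.2 hcon.le)))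

/-- The dual of `C₀(D, ℝ)`, for a discrete space `D`, consists of absolutely summable families. -/
theorem summable_abs_apply_zeroAtInftySingle (φ : StrongDual ℝ C₀(D, ℝ)) :
    Summable fun d => |φ (zeroAtInftySingle d)| := by
  classical
  refine summable_of_sum_le (c := ‖φ‖) (fun d => abs_nonneg _) fun s => ?_
  have h₁ : ∑ d ∈ s, |φ (zeroAtInftySingle d)| =
      φ (∑ d ∈ s, (SignType.sign (φ (zeroAtInftySingle d)) : ℝ) • zeroAtInftySingle d) := by
    simp [map_sum, sign_mul_self]
  rw [h₁]
  refine (le_abs_self _).trans ((φ.le_opNorm _).trans (mul_le_of_le_one_right (norm_nonneg _) ?_))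
  refine norm_zeroAtInfty_le zero_le_one fun d => ?_
  rw [sum_smul_zeroAtInftySingle_apply]
  split_ifs
  · rcases SignType.sign (φ (zeroAtInftySingle d)) with _ | _ | _ <;> simp
  · simp

variable {F : Type*} [NormedAddCommGroup F] [NormedSpace ℝ F]

/-- The operator `y ↦ (d ↦ f d y)` into `C₀(D, ℝ)` given by a bounded family of functionals that
vanishes at infinity pointwise. -/
noncomputable def toZeroAtInfty (f : D → StrongDual ℝ F) (C : ℝ) (hC : ∀ d, ‖f d‖ ≤ C)
    (hf : ∀ y, Tendsto (fun d => f d y) (cocompact D) (𝓝 0)) : F →L[ℝ] C₀(D, ℝ) :=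
  LinearMap.mkContinuous
    { toFun := fun y => zeroAtInftyOfTendsto (fun d => f d y) (hf y)
      map_add' := fun y z => by
        ext d
        exact map_add (f d) y z
      map_smul' := fun r y => by
        ext d
        exact map_smul (f d) r y } (max C 0) fun y => by
    refine norm_zeroAtInfty_le (by positivity) fun d => ((f d).le_opNorm y).trans ?_
    gcongr
    exact (hC d).trans (le_max_left _ _)

/-- If `f` vanishes at infinity weakly, then `y ↦ (d ↦ f d y)` is weakly compact: the second adjoint
`ξ ↦ (d ↦ ξ (f d))` still takes values in `C₀(D, ℝ)`, is continuous from the weak-* to the weak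
topology, and maps the weak-* compact unit ball of the bidual onto a weakly compact set containing
the image of the unit ball. -/
theorem isWeaklyCompactOperator_toZeroAtInfty (f : D → StrongDual ℝ F) (C : ℝ)
    (hC : ∀ d, ‖f d‖ ≤ C) (hf : ∀ y, Tendsto (fun d => f d y) (cocompact D) (𝓝 0))
    (hf' : ∀ ξ : StrongDual ℝ (StrongDual ℝ F), Tendsto (fun d => ξ (f d)) (cocompact D) (𝓝 0)) :
    IsWeaklyCompactOperator (toZeroAtInfty f C hC hf) := by
  let Φ : WeakDual ℝ (StrongDual ℝ F) → WeakSpace ℝ C₀(D, ℝ) := fun ξ =>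
    toWeakSpace ℝ _ (zeroAtInftyOfTendsto (fun d => ξ (f d)) (hf' (WeakDual.toStrongDual ξ)))
  have hΦ : Continuous Φ := by
    refine WeakBilin.continuous_of_continuous_eval _ fun φ => ?_
    -- On the range of `Φ`, the functional `φ` acts as evaluation at the element `g` of the dual.
    let g : StrongDual ℝ F := ∑' d, φ (zeroAtInftySingle d) • f d
    have hg : Summable fun d => φ (zeroAtInftySingle d) • f d := by
      refine Summable.of_norm_bounded ((summable_abs_apply_zeroAtInftySingle φ).mul_right C)
        fun d => ?_
      rw [norm_smul, Real.norm_eq_abs]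
      gcongr
      exact hC d
    have heq : ∀ ξ : WeakDual ℝ (StrongDual ℝ F),
        φ (zeroAtInftyOfTendsto (fun d => ξ (f d)) (hf' (WeakDual.toStrongDual ξ))) = ξ g := by
      intro ξ
      have h₁ := (hasSum_zeroAtInftySingle
        (zeroAtInftyOfTendsto (fun d => ξ (f d)) (hf' (WeakDual.toStrongDual ξ)))).mapL φ
      have h₂ := hg.hasSum.mapL (WeakDual.toStrongDual ξ)
      refine h₁.unique (HasSum.congr_fun h₂ fun d => ?_)
      simp only [map_smul, smul_eq_mul]
      exact mul_comm _ _
    exact (WeakDual.eval_continuous g).congr fun ξ => (heq ξ).symm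
  refine ((WeakDual.isCompact_closedBall (0 : StrongDual ℝ (StrongDual ℝ F)) 1).image
    hΦ).closure_of_subset ?_
  rintro _ ⟨_, ⟨y, hy, rfl⟩, rfl⟩
  refine ⟨StrongDual.toWeakDual (NormedSpace.inclusionInDoubleDualLi ℝ y), ?_, rfl⟩
  exact mem_closedBall_zero_iff.2 (((NormedSpace.inclusionInDoubleDualLi ℝ).norm_map y).trans_le
    (mem_closedBall_zero_iff.1 hy))

end WeaklyCompact

/-! ### The AM-compactness property -/

section AMCompact

universe v

variable {F : Type v} [NormedAddCommGroup F] [NormedSpace ℝ F] [Lattice F]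

theorem AMCompactnessProperty.uniformlyNullOnIntervals (hF : AMCompactnessProperty F)
    {f : ℕ → StrongDual ℝ F} (hf : WeaklyNull f) : UniformlyNullOnIntervals f := by
  intro w _ ε hε
  obtain ⟨C, hC⟩ := hf.exists_norm_le
  -- `AMCompactnessProperty` speaks of Banach spaces in the universe of `F`; hence `ULift ℕ`.
  have hdown : Tendsto (ULift.down : ULift.{v} ℕ → ℕ) (cocompact _) atTop := by
    rw [cocompact_eq_cofinite, ← Nat.cofinite_eq_atTop]
    exact ULift.down_injective.tendsto_cofinite
  have hf' : ∀ ξ : StrongDual ℝ (StrongDual ℝ F),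
      Tendsto (fun d : ULift.{v} ℕ => ξ (f d.down)) (cocompact _) (𝓝 0) :=
    fun ξ => (hf ξ).comp hdown
  have hfy : ∀ y, Tendsto (fun d : ULift.{v} ℕ => f d.down y) (cocompact _) (𝓝 0) :=
    fun y => hf' (NormedSpace.inclusionInDoubleDual ℝ F y)
  have htb := ((hF _ _ (isWeaklyCompactOperator_toZeroAtInfty (fun d : ULift.{v} ℕ => f d.down) C
    (fun d => hC d.down) hfy hf') 0 w).totallyBounded).subset subset_closure
  obtain ⟨t, ht, hcover⟩ := Metric.totallyBounded_iff.1 htb (ε / 2) (half_pos hε)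
  have hev : ∀ᶠ n in atTop, ∀ x ∈ t, |x (ULift.up n)| < ε / 2 := by
    refine (eventually_all_finite ht).2 fun x _ => ?_
    have hup : Tendsto (ULift.up.{v} : ℕ → ULift.{v} ℕ) atTop (cocompact _) := by
      rw [cocompact_eq_cofinite, ← Nat.cofinite_eq_atTop]
      exact ULift.up_injective.tendsto_cofinite
    exact ((ZeroAtInftyContinuousMapClass.zero_at_infty x).comp hup).abs.eventually_lt_const
      (by simpa using hε)
  filter_upwards [hev] with n hn y hy0 hyw
  obtain ⟨x, hxt, hx⟩ := Set.mem_iUnion₂.1 (hcover ⟨y, ⟨hy0, hyw⟩, rfl⟩)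
  rw [Metric.mem_ball, dist_eq_norm] at hx
  have h₁ := (abs_apply_le_norm_zeroAtInfty _ (ULift.up n)).trans hx.le
  rw [ZeroAtInftyContinuousMap.sub_apply] at h₁
  have h₂ := abs_sub_abs_le_abs_sub (f n y) (x (ULift.up n))
  have h₃ : |f n y - x (ULift.up n)| ≤ ε / 2 := h₁
  linarith [hn x hxt]

end AMCompact

end BanachLat

theorem theorem4p4 {E : Type*} {F : Type*}
    [NormedAddCommGroup E] [NormedSpace ℝ E] [CompleteSpace E]
    [Lattice E] [IsOrderedAddMonoid E] [IsOrderedModule ℝ E] [HasSolidNorm E]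
    [NormedAddCommGroup F] [NormedSpace ℝ F] [CompleteSpace F]
    [Lattice F] [IsOrderedAddMonoid F] [IsOrderedModule ℝ F] [HasSolidNorm F]
    (h : BanachLat.WeaklySeqContLatticeOps E ∨
      (BanachLat.IsDiscreteLattice F ∧ BanachLat.OrderContinuousNorm F) ∨
      BanachLat.AMCompactnessProperty F)
    (T : E →L[ℝ] F) (hpos : BanachLat.IsPositiveOperator T)
    (huaw : BanachLat.IsUawDunfordPettis T) :
    BanachLat.IsWeakDunfordPettis T := by
  intro x f hx hf
  obtain ⟨M, hM⟩ := hx.exists_norm_le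
  obtain ⟨C, hC⟩ := hf.exists_norm_le
  rcases h with hE | ⟨hd, hoc⟩ | hAM
  · have huawx : BanachLat.UawTendsto x 0 := fun w hw => by
      simp only [sub_zero]
      exact (hE x hx).of_nonneg_of_le (fun n => le_inf (abs_nonneg _) hw) fun n => inf_le_left
    refine squeeze_zero_norm (fun n => ((f n).le_opNorm _).trans
      (mul_le_mul_of_nonneg_right (hC n) (norm_nonneg _))) ?_
    simpa using (huaw x ⟨M, hM⟩ huawx).const_mul C
  · exact huaw.tendsto_of_uniformlyNullOnIntervals hpos hC
      (BanachLat.uniformlyNullOnIntervals_of_isDiscreteLattice hd hoc hC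
        fun y => hf (NormedSpace.inclusionInDoubleDual ℝ F y)) hM
  · exact huaw.tendsto_of_uniformlyNullOnIntervals hpos hC (hAM.uniformlyNullOnIntervals hf) hM
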